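/- Let $F^2$ be the Fock space of all entire functions $f$ with $\|f\|^2=\int_{\mathbb C}|f|^2\,d\lambda<\infty$, where $d\lambda(z)=\frac1\pi e^{-|z|^2}\,dA(z)$ and $dA$ is area measure; its inner product is that of $L^2(\mathbb C,d\lambda)$. For $a\in\mathbb C$ let $W_a$ be the Weyl operator on $F^2$, $W_af(z)=f(z-a)\,e^{z\overline a-|a|^2/2}$. For real $a,b$ let $T_af(x)=f(x-a)$ and $M_bf(x)=e^{2\pi ibx}f(x)$ on $L^2(\mathbb R)$. Let $B$ be the Bargmann transform $$Bf(z)=(2/\pi)^{1/4}\int_{\mathbb R}f(x)\,e^{2xz-x^2-z^2/2}\,dx .$$ The integral converges absolutely for all $f\in L^2(\mathbb R)$ and $z\in\mathbb C$, and $B$ is a unitary operator from $L^2(\mathbb R)$ onto $F^2$. For every real $b$, $$BM_bB^{-1}=W_{-\pi bi},$$ and for all real $a,b$, $$B(M_bT_a)B^{-1}=e^{\pi abi}\,W_{a-\pi bi};$$ consequently, $B(M_bT_ag)=e^{\pi abi}\,W_{a-\pi bi}(Bg)$ for every $g\in L^2(\mathbb R)$. -/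

import Mathlib

open MeasureTheory Complex
open scoped ENNReal ComplexConjugate

noncomputable section

/-! ### The Hilbert space `L²(ℝ)` and the modulation and translation operators -/

/-- The complex Hilbert space `L²(ℝ) = L²(ℝ, dx)`. -/
abbrev L2R : Type := Lp ℂ 2 (volume : Measure ℝ)

/-- The unimodular function `x ↦ e^{2πibx}`. -/
def modulationFactor (b x : ℝ) : ℂ := Complex.exp (2 * Real.pi * Complex.I * b * x)

lemma norm_modulationFactor (b x : ℝ) : ‖modulationFactor b x‖ = 1 := by
  have h : (2 * Real.pi * Complex.I * b * x : ℂ) = ((2 * Real.pi * b * x : ℝ) : ℂ) * Complex.I := by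
    push_cast; ring
  rw [modulationFactor, h, Complex.norm_exp_ofReal_mul_I]

lemma continuous_modulationFactor (b : ℝ) : Continuous (modulationFactor b) := by
  unfold modulationFactor; fun_prop

lemma memLp_modulation (b : ℝ) (f : L2R) :
    MemLp (fun x => modulationFactor b x * f x) 2 (volume : Measure ℝ) := by
  refine (Lp.memLp f).of_le
    ((continuous_modulationFactor b).aestronglyMeasurable.mul (Lp.aestronglyMeasurable f)) ?_
  filter_upwards with x
  simp [norm_modulationFactor]

/-- The modulation operator `M_b f (x) = e^{2πibx} f(x)` on `L²(ℝ)`. -/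
def modulation (b : ℝ) : L2R →L[ℂ] L2R :=
  LinearMap.mkContinuous
    { toFun := fun f => (memLp_modulation b f).toLp _
      map_add' := by
        intro f g
        apply Lp.ext
        filter_upwards [(memLp_modulation b (f + g)).coeFn_toLp, (memLp_modulation b f).coeFn_toLp,
          (memLp_modulation b g).coeFn_toLp, Lp.coeFn_add f g,
          Lp.coeFn_add ((memLp_modulation b f).toLp _) ((memLp_modulation b g).toLp _)]
          with x h1 h2 h3 h4 h5
        rw [h1, h5, Pi.add_apply, h2, h3, h4, Pi.add_apply, mul_add]
      map_smul' := by
        intro c f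
        apply Lp.ext
        filter_upwards [(memLp_modulation b (c • f)).coeFn_toLp, (memLp_modulation b f).coeFn_toLp,
          Lp.coeFn_smul c f, Lp.coeFn_smul c ((memLp_modulation b f).toLp _)] with x h1 h2 h3 h4
        rw [h1, RingHom.id_apply, h4, Pi.smul_apply, h2, h3, Pi.smul_apply, smul_eq_mul,
          smul_eq_mul]
        ring }
    1 (by
      intro f
      rw [one_mul]
      apply Lp.norm_le_norm_of_ae_le
      filter_upwards [(memLp_modulation b f).coeFn_toLp] with x h1
      simp only [LinearMap.coe_mk, AddHom.coe_mk]
      rw [h1, norm_mul, norm_modulationFactor, one_mul])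

lemma coeFn_modulation (b : ℝ) (f : L2R) :
    modulation b f =ᵐ[volume] fun x => Complex.exp (2 * Real.pi * Complex.I * b * x) * f x :=
  (memLp_modulation b f).coeFn_toLp

/-- The translation operator `T_a f (x) = f(x - a)` on `L²(ℝ)`. -/
def translation (a : ℝ) : L2R →L[ℂ] L2R :=
  (Lp.compMeasurePreservingₗᵢ ℂ (fun x : ℝ => x - a)
    (measurePreserving_sub_right volume a)).toContinuousLinearMap

lemma coeFn_translation (a : ℝ) (f : L2R) :
    translation a f =ᵐ[volume] fun x => f (x - a) :=
  Lp.coeFn_compMeasurePreserving f (measurePreserving_sub_right volume a)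

/-! ### The Fock space -/

/-- The Gaussian measure `dλ(z) = π⁻¹ e^{-|z|²} dA(z)` on `ℂ`. -/
def fockMeasure : Measure ℂ :=
  (volume : Measure ℂ).withDensity fun z => ENNReal.ofReal (Real.pi⁻¹ * Real.exp (-‖z‖ ^ 2))

/-- The entire functions that are square integrable for the Gaussian measure. -/
def fockSubmodule : Submodule ℂ (ℂ → ℂ) where
  carrier := {f | Differentiable ℂ f ∧ MemLp f 2 fockMeasure}
  add_mem' := fun hf hg => ⟨hf.1.add hg.1, hf.2.add hg.2⟩
  zero_mem' := ⟨differentiable_const 0, MemLp.zero⟩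
  smul_mem' := fun c _ hf => ⟨hf.1.const_smul c, hf.2.const_smul c⟩

/-- The Fock space `F²`; its inner product is the one of `L²(ℂ, dλ)`. -/
def FockSpace : Type := fockSubmodule

namespace FockSpace

instance : AddCommGroup FockSpace := inferInstanceAs (AddCommGroup fockSubmodule)

instance : Module ℂ FockSpace := inferInstanceAs (Module ℂ fockSubmodule)

instance : CoeFun FockSpace (fun _ => ℂ → ℂ) := ⟨fun f => f.1⟩

lemma differentiable (f : FockSpace) : Differentiable ℂ f := f.2.1

lemma memLp (f : FockSpace) : MemLp f 2 fockMeasure := f.2.2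

lemma add_apply (f g : FockSpace) (z : ℂ) : (f + g) z = f z + g z := rfl

lemma smul_apply (c : ℂ) (f : FockSpace) (z : ℂ) : (c • f) z = c * f z := rfl

@[ext] lemma ext {f g : FockSpace} (h : ∀ z, f z = g z) : f = g := Subtype.ext (funext h)

/-- The inclusion of `F²` into `L²(ℂ, dλ)`. -/
def toL2 : FockSpace →ₗ[ℂ] Lp ℂ 2 fockMeasure where
  toFun f := f.memLp.toLp f
  map_add' _ _ := rfl
  map_smul' _ _ := rfl

lemma volume_absolutelyContinuous : (volume : Measure ℂ) ≪ fockMeasure := by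
  refine withDensity_absolutelyContinuous' (by fun_prop) ?_
  filter_upwards with z
  have : 0 < Real.pi⁻¹ * Real.exp (-‖z‖ ^ 2) := by positivity
  simpa using this

lemma toL2_injective : Function.Injective toL2 := by
  intro f g h
  have h1 : (f : ℂ → ℂ) =ᵐ[fockMeasure] g := (MemLp.toLp_eq_toLp_iff f.memLp g.memLp).1 h
  have h2 : (f : ℂ → ℂ) =ᵐ[volume] g := volume_absolutelyContinuous.ae_eq h1
  exact Subtype.ext
    ((Continuous.ae_eq_iff_eq volume f.differentiable.continuous g.differentiable.continuous).1 h2)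

instance : NormedAddCommGroup FockSpace :=
  NormedAddCommGroup.induced FockSpace (Lp ℂ 2 fockMeasure) toL2 toL2_injective

instance : InnerProductSpace ℂ FockSpace where
  inner f g := inner ℂ (toL2 f) (toL2 g)
  norm_smul_le c f := by
    change ‖toL2 (c • f)‖ ≤ ‖c‖ * ‖toL2 f‖
    rw [map_smul, norm_smul]
  norm_sq_eq_re_inner f := norm_sq_eq_re_inner (𝕜 := ℂ) (toL2 f)
  conj_inner_symm f g := inner_conj_symm (toL2 f) (toL2 g)
  add_left f g h := by
    change inner ℂ (toL2 (f + g)) (toL2 h) = _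
    rw [map_add, inner_add_left]
  smul_left f g c := by
    change inner ℂ (toL2 (c • f)) (toL2 g) = _
    rw [map_smul, inner_smul_left]

lemma norm_def (f : FockSpace) : ‖f‖ = (eLpNorm f 2 fockMeasure).toReal :=
  Lp.norm_toLp f f.memLp

end FockSpace

/-! ### Weyl operators -/

/-- The normalized reproducing kernel `k_a(z) = e^{z ā - |a|²/2}` of `F²` at `a`. -/
def normalizedKernel (a z : ℂ) : ℂ := Complex.exp (z * conj a - (‖a‖ : ℂ) ^ 2 / 2)

/-- The function `z ↦ f(z - a) k_a(z)`. -/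
def weylFun (a : ℂ) (f : ℂ → ℂ) (z : ℂ) : ℂ := f (z - a) * normalizedKernel a z

lemma differentiable_weylFun (a : ℂ) {f : ℂ → ℂ} (hf : Differentiable ℂ f) :
    Differentiable ℂ (weylFun a f) := by
  unfold weylFun normalizedKernel
  fun_prop

lemma norm_normalizedKernel_sq (a z : ℂ) :
    ‖normalizedKernel a z‖ ^ 2 * Real.exp (-‖z‖ ^ 2) = Real.exp (-‖z - a‖ ^ 2) := by
  rw [normalizedKernel, Complex.norm_exp, ← Real.exp_nat_mul, ← Real.exp_add]
  congr 1
  have h1 : ((‖a‖ : ℂ) ^ 2 / 2).re = ‖a‖ ^ 2 / 2 := by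
    rw [show ((‖a‖ : ℂ) ^ 2 / 2) = ((‖a‖ ^ 2 / 2 : ℝ) : ℂ) by push_cast; ring, Complex.ofReal_re]
  rw [Complex.sub_re, h1]
  simp only [Complex.sq_norm, Complex.normSq_apply, Complex.mul_re, Complex.conj_re,
    Complex.conj_im, Complex.sub_re, Complex.sub_im]
  push_cast
  ring

lemma eLpNorm_weylFun (a : ℂ) {f : ℂ → ℂ} (hf : Differentiable ℂ f) :
    eLpNorm (weylFun a f) 2 fockMeasure = eLpNorm f 2 fockMeasure := by
  have key : ∀ g : ℂ → ℂ, Continuous g → ∫⁻ z, ‖g z‖ₑ ^ (2 : ℝ) ∂fockMeasure =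
      ∫⁻ z, ENNReal.ofReal (Real.pi⁻¹ * (‖g z‖ ^ 2 * Real.exp (-‖z‖ ^ 2))) := by
    intro g hg
    rw [fockMeasure, lintegral_withDensity_eq_lintegral_mul _ (by fun_prop)
      (hg.enorm.measurable.pow_const _)]
    refine lintegral_congr fun z => ?_
    rw [Pi.mul_apply, ← ofReal_norm, ENNReal.ofReal_rpow_of_nonneg (norm_nonneg _)
      (by norm_num), ← ENNReal.ofReal_mul (by positivity)]
    congr 1
    rw [Real.rpow_two]
    ring
  rw [eLpNorm_eq_lintegral_rpow_enorm_toReal (by norm_num) (by norm_num),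
    eLpNorm_eq_lintegral_rpow_enorm_toReal (by norm_num) (by norm_num)]
  congr 1
  simp only [ENNReal.toReal_ofNat]
  rw [key _ (differentiable_weylFun a hf).continuous, key _ hf.continuous,
    ← lintegral_sub_right_eq_self
      (fun z => ENNReal.ofReal (Real.pi⁻¹ * (‖f z‖ ^ 2 * Real.exp (-‖z‖ ^ 2)))) a]
  refine lintegral_congr fun z => ?_
  rw [weylFun, norm_mul, mul_pow, mul_assoc, norm_normalizedKernel_sq]

lemma memLp_weylFun (a : ℂ) (f : FockSpace) : MemLp (weylFun a f) 2 fockMeasure :=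
  ⟨(differentiable_weylFun a f.differentiable).continuous.aestronglyMeasurable, by
    rw [eLpNorm_weylFun a f.differentiable]; exact f.memLp.2⟩

/-- The Weyl operator `W_a f (z) = f(z - a) k_a(z) = f(z - a) e^{z ā - |a|²/2}` on `F²`. -/
def weyl (a : ℂ) : FockSpace →L[ℂ] FockSpace :=
  LinearMap.mkContinuous
    { toFun := fun f =>
        ⟨weylFun a f, differentiable_weylFun a f.differentiable, memLp_weylFun a f⟩
      map_add' := by
        intro f g
        ext z
        change (f (z - a) + g (z - a)) * _ = f (z - a) * _ + g (z - a) * _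
        rw [add_mul]
      map_smul' := by
        intro c f
        ext z
        change (c * f (z - a)) * _ = c * (f (z - a) * _)
        rw [mul_assoc] }
    1 (by
      intro f
      rw [one_mul, FockSpace.norm_def, FockSpace.norm_def]
      exact (congrArg ENNReal.toReal (eLpNorm_weylFun a f.differentiable)).le)

lemma weyl_apply (a : ℂ) (f : FockSpace) (z : ℂ) :
    weyl a f z = f (z - a) * Complex.exp (z * conj a - (‖a‖ : ℂ) ^ 2 / 2) := rfl

/-! ### The Bargmann transform -/

/-- The integrand `f(x) e^{2xz - x² - z²/2}` of the Bargmann transform. -/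
def bargmannIntegrand (f : ℝ → ℂ) (z : ℂ) (x : ℝ) : ℂ :=
  f x * Complex.exp (2 * x * z - x ^ 2 - z ^ 2 / 2)

/-- The Bargmann integral `c ∫ f(x) e^{2xz - x² - z²/2} dx` with `c = (2/π)^{1/4}`. -/
def bargmannIntegral (f : ℝ → ℂ) (z : ℂ) : ℂ :=
  (((2 / Real.pi) ^ (1 / 4 : ℝ) : ℝ) : ℂ) * ∫ x : ℝ, bargmannIntegrand f z x

/-- The unitary operator `B : L²(ℝ) → F²` is the Bargmann transform: the integral defining it
converges absolutely for all `f` and `z`, and `(B f)(z)` is its value. As elements of `F²` are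
functions, at most one `B` has this property. -/
def IsBargmannTransform (B : L2R ≃ₗᵢ[ℂ] FockSpace) : Prop :=
  ∀ (f : L2R) (z : ℂ), Integrable (bargmannIntegrand f z) ∧ B f z = bargmannIntegral f z

lemma IsBargmannTransform.unique {B B' : L2R ≃ₗᵢ[ℂ] FockSpace} (h : IsBargmannTransform B)
    (h' : IsBargmannTransform B') : B = B' :=
  LinearIsometryEquiv.ext fun f => FockSpace.ext fun z => by rw [(h f z).2, (h' f z).2]

end

open Filter Topology

/-! The Bargmann integral at `w` is the inner product with a Gaussian `gaussianState w` in L²(ℝ),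
and evaluation at `w` on F² is the inner product with `FockSpace.kernel w`. Both families have the
Gram matrix e^{w v̄}, and both are total: the kernels because they reproduce point values, the
Gaussians by injectivity of the Fourier transform. As both spaces are complete, a unitary B sends
one family to the other, and ⟨K_w, Bf⟩ = ⟨B⁻¹K_w, f⟩ identifies Bf with the Bargmann integral
(`exists_isBargmannTransform`).

The intertwining relations are then a pointwise identity: expand the exponent and translate the
integration variable by a (`bargmannIntegral_modulation_translation`). -/

/-! ### Mean value property for the Gaussian measure. -/

instance isProbabilityMeasure_fockMeasure : IsProbabilityMeasure fockMeasure := by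
  have hint : Integrable (fun z : ℂ => Real.exp (-1 * ‖z‖ ^ 2)) := by
    have h := (GaussianFourier.integrable_cexp_neg_mul_sq_norm_add (V := ℂ) (b := 1)
      (by simp) 0 0).norm
    refine h.congr (Eventually.of_forall fun z => ?_)
    simp [Complex.norm_exp, ← Complex.ofReal_pow]
  have hval := GaussianFourier.integral_rexp_neg_mul_sq_norm (V := ℂ) one_pos
  refine ⟨?_⟩
  rw [fockMeasure, withDensity_apply _ MeasurableSet.univ, Measure.restrict_univ,
    ← ofReal_integral_eq_lintegral_ofReal, integral_const_mul]
  · simp only [neg_mul, one_mul] at hval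
    rw [hval]
    simp [Complex.finrank_real_complex, Real.pi_ne_zero]
  · simpa using hint.const_mul Real.pi⁻¹
  · exact Eventually.of_forall fun z => by positivity

lemma measurePreserving_rotation_fockMeasure (u : Circle) :
    MeasurePreserving (rotation u) fockMeasure fockMeasure := by
  have hm : Measurable (rotation u) := (rotation u).continuous.measurable
  have hv := (rotation u).measurePreserving
  refine ⟨hm, Measure.ext fun s hs => ?_⟩
  rw [Measure.map_apply hm hs, fockMeasure, withDensity_apply _ hs,
    withDensity_apply _ (hm hs), ← hv.setLIntegral_comp_preimage hs (by fun_prop)]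
  simp only [LinearIsometryEquiv.norm_map]

/-- The mean value property of entire functions with respect to the Gaussian measure. -/
lemma integral_fockMeasure {f : ℂ → ℂ} (hf : Differentiable ℂ f) (hi : Integrable f fockMeasure) :
    ∫ z, f z ∂fockMeasure = f 0 := by
  -- Average over rotations: each rotation preserves the measure, while for fixed z the average of f
  -- over the circle through z is f 0. Fubini compares the two.
  have hcirc : ∀ z, ∫ θ in (0 : ℝ)..2 * Real.pi, f (circleMap 0 1 θ * z) =
      (2 * Real.pi : ℝ) • f 0 := by
    intro z
    have h := DiffContOnCl.circleAverage (c := 0) (R := 1)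
      (show Differentiable ℂ fun w => f (w * z) by fun_prop).diffContOnCl
    rw [Real.circleAverage_def, zero_mul, inv_smul_eq_iff₀ (by positivity)] at h
    exact h
  have hrot : ∀ θ : ℝ, (fun z => f (circleMap 0 1 θ * z)) = f ∘ rotation (Circle.exp θ) := by
    intro θ
    ext z
    simp [circleMap, rotation_apply]
  have hmp := fun θ : ℝ => measurePreserving_rotation_fockMeasure (Circle.exp θ)
  have hemb := fun θ : ℝ =>
    (rotation (Circle.exp θ)).toHomeomorph.measurableEmbedding
  have hint : ∀ θ : ℝ, ∫ z, f (circleMap 0 1 θ * z) ∂fockMeasure = ∫ z, f z ∂fockMeasure := by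
    intro θ
    rw [hrot θ]
    exact (hmp θ).integral_comp (hemb θ) f
  have hprod : Integrable (Function.uncurry fun (θ : ℝ) (z : ℂ) => f (circleMap 0 1 θ * z))
      ((volume.restrict (Set.Ioc 0 (2 * Real.pi))).prod fockMeasure) := by
    have hc : Continuous (Function.uncurry fun (θ : ℝ) (z : ℂ) => f (circleMap 0 1 θ * z)) := by
      have := hf.continuous
      unfold Function.uncurry circleMap
      fun_prop
    refine (integrable_prod_iff hc.aestronglyMeasurable).2 ⟨Eventually.of_forall fun θ => ?_, ?_⟩
    · change Integrable (fun z => f (circleMap 0 1 θ * z)) _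
      rw [hrot θ]
      exact (hmp θ).integrable_comp_of_integrable hi
    · have h : ∀ θ : ℝ, ∫ z, ‖f (circleMap 0 1 θ * z)‖ ∂fockMeasure =
          ∫ z, ‖f z‖ ∂fockMeasure := by
        intro θ
        rw [← (hmp θ).integral_comp (hemb θ) fun z => ‖f z‖]
        simp [circleMap, rotation_apply]
      simp only [Function.uncurry, h]
      exact integrable_const _
  have hswap := integral_integral_swap hprod
  simp only [hint] at hswap
  simp only [← intervalIntegral.integral_of_le (show 0 ≤ 2 * Real.pi by positivity), hcirc] at hswap
  rw [integral_const, probReal_univ, one_smul, intervalIntegral.integral_const, sub_zero] at hswap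
  exact smul_right_injective ℂ (by positivity : 2 * Real.pi ≠ 0) hswap

/-! ### Reproducing kernel and completeness of F². -/

namespace FockSpace

/-- The inclusion of `F²` into `L²(ℂ, dλ)` as a linear isometry. -/
noncomputable def toL2Isometry : FockSpace →ₗᵢ[ℂ] Lp ℂ 2 fockMeasure := ⟨toL2, fun _ => rfl⟩

lemma coeFn_toL2 (f : FockSpace) : toL2 f =ᵐ[fockMeasure] f := f.memLp.coeFn_toLp

/-- The constant function `1` in the Fock space. -/
noncomputable def one : FockSpace := ⟨fun _ => 1, differentiable_const 1, memLp_const 1⟩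

/-- The reproducing property at the origin, from the mean value property; Weyl operators carry it to
every other point. -/
lemma inner_one (f : FockSpace) : inner ℂ one f = f 0 := by
  change inner ℂ (toL2 one) (toL2 f) = _
  rw [L2.inner_def, ← integral_fockMeasure f.differentiable (f.memLp.integrable one_le_two)]
  refine integral_congr_ae ?_
  filter_upwards [coeFn_toL2 one, coeFn_toL2 f] with z h1 h2
  rw [h1, h2]
  simp [one]

/-- The Weyl operators as linear isometries. -/
noncomputable def weylIsometry (a : ℂ) : FockSpace →ₗᵢ[ℂ] FockSpace :=
  ⟨(weyl a).toLinearMap, fun f => by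
    rw [norm_def, norm_def]
    exact congrArg ENNReal.toReal (eLpNorm_weylFun a f.differentiable)⟩

lemma weyl_weyl_neg (a : ℂ) (f : FockSpace) : weyl a (weyl (-a) f) = f := by
  ext z
  rw [weyl_apply, weyl_apply, mul_assoc, ← Complex.exp_add]
  have h : (z - a) * conj (-a) - (‖-a‖ : ℂ) ^ 2 / 2 + (z * conj a - (‖a‖ : ℂ) ^ 2 / 2) = 0 := by
    rw [norm_neg, ← Complex.mul_conj', map_neg]
    ring
  rw [h, Complex.exp_zero, mul_one, sub_neg_eq_add, sub_add_cancel]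

/-- The reproducing kernel `K_w(z) = e^{z w̄}` of the Fock space. -/
noncomputable def kernel (w : ℂ) : FockSpace := (Complex.exp ((‖w‖ : ℂ) ^ 2 / 2)) • weyl w one

lemma kernel_apply (w z : ℂ) : kernel w z = Complex.exp (z * conj w) := by
  rw [kernel, smul_apply, weyl_apply]
  change _ * (1 * _) = _
  rw [one_mul, ← Complex.exp_add]
  congr 1
  ring

/-- W_w is isometric with right inverse W_{-w}, so ⟨W_w 1, f⟩ = ⟨1, W_{-w} f⟩ = (W_{-w} f)(0) = f(w)
e^{-|w|²/2}; the scalar in `kernel` cancels the exponential. -/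
lemma inner_kernel (w : ℂ) (f : FockSpace) : inner ℂ (kernel w) f = f w := by
  rw [kernel, inner_smul_left, ← weyl_weyl_neg w f,
    show inner ℂ (weyl w one) (weyl w (weyl (-w) f)) = inner ℂ one (weyl (-w) f) from
      (weylIsometry w).inner_map_map _ _, inner_one, weyl_weyl_neg, weyl_apply, ← Complex.exp_conj,
    mul_comm, mul_assoc, ← Complex.exp_add]
  have h : conj ((‖w‖ : ℂ) ^ 2 / 2) = (‖w‖ : ℂ) ^ 2 / 2 := by
    simp [Complex.conj_ofReal, Complex.conj_ofNat]
  rw [h]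
  simp

lemma norm_kernel_sq (w : ℂ) : ‖kernel w‖ ^ 2 = Real.exp (‖w‖ ^ 2) := by
  have h := inner_self_eq_norm_sq_to_K (𝕜 := ℂ) (kernel w)
  rw [inner_kernel, kernel_apply, Complex.mul_conj'] at h
  refine Complex.ofReal_injective ?_
  push_cast
  exact h.symm

lemma continuous_norm_kernel : Continuous fun w => ‖kernel w‖ := by
  have h : (fun w => ‖kernel w‖) = fun w => √(Real.exp (‖w‖ ^ 2)) := by
    ext w
    rw [← norm_kernel_sq, Real.sqrt_sq (norm_nonneg _)]
  rw [h]
  fun_prop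

/-- The L² limit G is only a class; its entire representative is h(z) = ⟨K_z, G⟩. By Cauchy–Schwarz
and local boundedness of ‖K_z‖ the convergence to h is locally uniform, so h is entire, and an a.e.
convergent subsequence gives h = G almost everywhere. -/
instance : CompleteSpace FockSpace := by
  refine Metric.complete_of_cauchySeq_tendsto fun u hu => ?_
  obtain ⟨G, hG⟩ := cauchySeq_tendsto_of_complete (u := fun n => toL2 (u n))
    (toL2Isometry.isometry.uniformContinuous.comp_cauchySeq hu)
  set h : ℂ → ℂ := fun z => inner ℂ (toL2 (kernel z)) G with hh
  have hbound : ∀ n z, dist (h z) (u n z) ≤ ‖kernel z‖ * ‖G - toL2 (u n)‖ := by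
    intro n z
    rw [dist_eq_norm, ← inner_kernel z (u n)]
    change ‖inner ℂ (toL2 (kernel z)) G - inner ℂ (toL2 (kernel z)) (toL2 (u n))‖ ≤ _
    rw [← inner_sub_right]
    exact norm_inner_le_norm _ _
  have hnorm : Tendsto (fun n => ‖G - toL2 (u n)‖) atTop (𝓝 0) := by
    have := (tendsto_const_nhds (x := G)).sub hG
    simpa using! this.norm
  have hloc : TendstoLocallyUniformlyOn (fun n => (u n : ℂ → ℂ)) h atTop Set.univ := by
    rw [tendstoLocallyUniformlyOn_iff_forall_isCompact isOpen_univ]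
    intro K _ hK
    obtain ⟨C, hC⟩ := hK.bddAbove_image continuous_norm_kernel.continuousOn
    rw [Metric.tendstoUniformlyOn_iff]
    intro ε hε
    have h0 : Tendsto (fun n => C * ‖G - toL2 (u n)‖) atTop (𝓝 0) := by
      simpa using hnorm.const_mul C
    filter_upwards [h0.eventually_lt_const hε] with n hn z hz
    exact ((hbound n z).trans (mul_le_mul_of_nonneg_right
      (hC (Set.mem_image_of_mem _ hz)) (norm_nonneg _))).trans_lt hn
  have hdiff : Differentiable ℂ h := differentiableOn_univ.1 <|
    hloc.differentiableOn (Eventually.of_forall fun n => (u n).differentiable.differentiableOn)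
      isOpen_univ
  have hpt : ∀ z, Tendsto (fun n => u n z) atTop (𝓝 (h z)) := fun z =>
    hloc.tendsto_at (Set.mem_univ z)
  have hae : h =ᵐ[fockMeasure] G := by
    obtain ⟨ns, hns, hlim⟩ := (tendstoInMeasure_of_tendsto_Lp hG).exists_seq_tendsto_ae
    filter_upwards [hlim, ae_all_iff.2 fun n => coeFn_toL2 (u n)] with z hz hu
    refine tendsto_nhds_unique ((hpt z).comp hns.tendsto_atTop) (hz.congr fun n => ?_)
    exact hu (ns n)
  let H : FockSpace := ⟨h, hdiff, (Lp.memLp G).ae_eq hae.symm⟩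
  have hH : toL2 H = G := Lp.ext ((coeFn_toL2 H).trans hae)
  refine ⟨H, toL2Isometry.isometry.isEmbedding.tendsto_nhds_iff.2 ?_⟩
  rw [show toL2Isometry H = G from hH]
  exact hG

end FockSpace

/-! ### Injectivity of the Fourier transform on L¹(ℝ). -/

section Fourier
open scoped FourierTransform ContDiff

/-- An integrable function with vanishing Fourier transform vanishes almost everywhere. -/
lemma ae_eq_zero_of_fourier_eq_zero {F : ℝ → ℂ} (hF : Integrable F) (h : 𝓕 F = 0) :
    F =ᵐ[volume] 0 := by
  refine ae_eq_zero_of_integral_contDiff_smul_eq_zero hF.locallyIntegrable fun g hg hgc => ?_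
  let G : SchwartzMap ℝ ℂ := HasCompactSupport.toSchwartzMap (f := fun x => (g x : ℂ))
    (hgc.comp_left (g := fun x : ℝ => (x : ℂ)) Complex.ofReal_zero)
    (Complex.ofRealCLM.contDiff.comp hg)
  -- Self-adjointness of 𝓕 applied to 𝓕⁻G and F: the left side becomes ∫ G F, the right side
  -- vanishes.
  have hflip : ∫ ξ, 𝓕 ((𝓕⁻ G : SchwartzMap ℝ ℂ) : ℝ → ℂ) ξ • F ξ =
      ∫ x, (𝓕⁻ G : SchwartzMap ℝ ℂ) x • 𝓕 F x := by
    have hG : Integrable ((𝓕⁻ G : SchwartzMap ℝ ℂ) : ℝ → ℂ) := (𝓕⁻ G).integrable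
    simpa using! VectorFourier.integral_fourierIntegral_smul_eq_flip (L := innerₗ ℝ)
      Real.continuous_fourierChar continuous_inner hG hF
  rw [← SchwartzMap.fourier_coe, FourierTransform.fourier_fourierInv_eq, h] at hflip
  have hGg : ∀ x, G x = g x := fun _ => rfl
  simpa [hGg] using hflip

end Fourier

/-! ### Gaussian states and the Bargmann integral. -/

/-- The constant `(2/π)^{1/4}` of the Bargmann transform. -/
noncomputable def bargmannConst : ℂ := (((2 / Real.pi) ^ (1 / 4 : ℝ) : ℝ) : ℂ)

lemma bargmannConst_ne_zero : bargmannConst ≠ 0 :=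
  Complex.ofReal_ne_zero.2 (by positivity)

lemma conj_bargmannConst : conj bargmannConst = bargmannConst := Complex.conj_ofReal _

/-- The normalization that makes the Gram matrices agree: √(π/2) is the integral of e^{-2x²},
written as a complex power to match `integral_cexp_quadratic`. -/
lemma bargmannConst_sq_mul : bargmannConst * bargmannConst * (Real.pi / 2 : ℂ) ^ (1 / 2 : ℂ) = 1 := by
  have h : (Real.pi / 2 : ℂ) ^ (1 / 2 : ℂ) = (((Real.pi / 2) ^ (1 / 2 : ℝ) : ℝ) : ℂ) := by
    rw [Complex.ofReal_cpow (by positivity)]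
    push_cast
    rfl
  rw [h, bargmannConst]
  norm_cast
  rw [← Real.rpow_add (by positivity), show (1 / 4 : ℝ) + 1 / 4 = 1 / 2 by norm_num,
    ← Real.mul_rpow (by positivity) (by positivity), div_mul_div_cancel₀' (by norm_num)]
  simp [Real.pi_ne_zero]

lemma memLp_gaussian (z : ℂ) :
    MemLp (fun x : ℝ => Complex.exp (2 * x * z - x ^ 2 - z ^ 2 / 2)) 2 := by
  rw [memLp_two_iff_integrable_sq_norm (by fun_prop)]
  refine (integrable_cexp_quadratic (b := 2) (by simp) (4 * z) (-z ^ 2)).norm.congr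
    (Eventually.of_forall fun x => ?_)
  simp only
  rw [← norm_pow, ← Complex.exp_nat_mul]
  congr 2
  push_cast
  ring

lemma integrable_bargmannIntegrand (f : L2R) (z : ℂ) : Integrable (bargmannIntegrand f z) :=
  (Lp.memLp f).integrable_mul (memLp_gaussian z)

/-- The function `x ↦ (2/π)^{1/4} e^{2x w̄ - x² - w̄²/2}`, against which the inner product is the
Bargmann transform at `w`. -/
noncomputable def gaussianState (w : ℂ) : L2R :=
  bargmannConst • (memLp_gaussian (conj w)).toLp _

lemma coeFn_gaussianState (w : ℂ) : gaussianState w =ᵐ[volume] fun x : ℝ =>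
    bargmannConst * Complex.exp (2 * x * conj w - x ^ 2 - conj w ^ 2 / 2) := by
  filter_upwards [Lp.coeFn_smul bargmannConst ((memLp_gaussian (conj w)).toLp _),
    (memLp_gaussian (conj w)).coeFn_toLp] with x h1 h2
  rw [gaussianState, h1, Pi.smul_apply, h2, smul_eq_mul]

lemma bargmannIntegral_congr {f g : ℝ → ℂ} (h : f =ᵐ[volume] g) (z : ℂ) :
    bargmannIntegral f z = bargmannIntegral g z := by
  unfold bargmannIntegral bargmannIntegrand
  congr 1
  refine integral_congr_ae ?_
  filter_upwards [h] with x hx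
  rw [hx]

lemma inner_gaussianState (w : ℂ) (f : L2R) :
    inner ℂ (gaussianState w) f = bargmannIntegral f w := by
  rw [L2.inner_def, bargmannIntegral, ← integral_const_mul]
  refine integral_congr_ae ?_
  filter_upwards [coeFn_gaussianState w] with x hx
  rw [hx, RCLike.inner_apply, map_mul, conj_bargmannConst, ← Complex.exp_conj, bargmannIntegrand,
    ← bargmannConst]
  simp only [map_sub, map_mul, map_div₀, map_pow, Complex.conj_conj, Complex.conj_ofReal,
    Complex.conj_ofNat]
  ring

/-- By `inner_gaussianState` this is the Gram matrix of the Gaussian states. Completing the square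
contributes (w + v̄)²/2, of which only the cross term survives. -/
lemma bargmannIntegral_gaussianState (v w : ℂ) :
    bargmannIntegral (gaussianState v) w = Complex.exp (w * conj v) := by
  rw [bargmannIntegral_congr (coeFn_gaussianState v), bargmannIntegral, ← bargmannConst]
  have h : bargmannIntegrand (fun x : ℝ =>
      bargmannConst * Complex.exp (2 * x * conj v - x ^ 2 - conj v ^ 2 / 2)) w = fun x : ℝ =>
      bargmannConst * Complex.exp (-2 * x ^ 2 + 2 * (w + conj v) * x +
        (-w ^ 2 / 2 - conj v ^ 2 / 2)) := by
    ext x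
    rw [bargmannIntegrand, mul_assoc, ← Complex.exp_add]
    ring_nf
  rw [h, integral_const_mul, integral_cexp_quadratic (by simp), neg_neg, ← mul_assoc, ← mul_assoc,
    bargmannConst_sq_mul, one_mul]
  congr 1
  ring

/-- Totality of the Gaussian states. On the imaginary axis the Bargmann integral is, up to a nonzero
factor, the Fourier transform of f(x) e^{-x²}. -/
lemma eq_zero_of_bargmannIntegral_eq_zero {f : L2R} (h : ∀ z, bargmannIntegral f z = 0) :
    f = 0 := by
  have hF : bargmannIntegrand f 0 =ᵐ[volume] 0 := by
    refine ae_eq_zero_of_fourier_eq_zero (integrable_bargmannIntegrand f 0) ?_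
    ext t
    -- Chosen so that e^{2xz} is the Fourier character e^{-2πixt}.
    set z : ℂ := -(Real.pi * t * I) with hz
    have hint : ∫ x, bargmannIntegrand f z x = 0 :=
      (mul_eq_zero.1 (h z)).resolve_left bargmannConst_ne_zero
    rw [Real.fourier_real_eq_integral_exp_smul, Pi.zero_apply]
    refine Eq.trans ?_ ((congrArg (Complex.exp (z ^ 2 / 2) * ·) hint).trans (mul_zero _))
    rw [← integral_const_mul]
    congr 1
    ext x
    rw [bargmannIntegrand, bargmannIntegrand, smul_eq_mul, mul_left_comm, mul_left_comm (cexp _),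
      ← Complex.exp_add, ← Complex.exp_add]
    congr 2
    push_cast [hz]
    ring
  apply Lp.ext
  filter_upwards [hF, Lp.coeFn_zero ℂ 2 volume] with x hx h0
  rw [h0]
  exact (mul_eq_zero.1 hx).resolve_right (Complex.exp_ne_zero _)

/-! ### Existence of the unitary Bargmann transform. -/

/-- The linear combinations of a family with trivial orthogonal complement are dense. -/
lemma denseRange_linearCombination {ι H : Type*} [NormedAddCommGroup H] [InnerProductSpace ℂ H]
    [CompleteSpace H] {v : ι → H} (hv : ∀ x, (∀ i, inner ℂ (v i) x = 0) → x = 0) :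
    DenseRange (Finsupp.linearCombination ℂ v) := by
  rw [DenseRange, ← LinearMap.coe_range, Submodule.dense_iff_topologicalClosure_eq_top,
    Submodule.topologicalClosure_eq_top_iff, Submodule.eq_bot_iff]
  intro x hx
  refine hv x fun i => hx _ ⟨Finsupp.single i 1, ?_⟩
  simp

/-- Two total families with the same Gram matrix are exchanged by a unitary operator. -/
lemma exists_linearIsometryEquiv_of_inner_eq {ι H K : Type*} [NormedAddCommGroup H]
    [InnerProductSpace ℂ H] [CompleteSpace H] [NormedAddCommGroup K] [InnerProductSpace ℂ K]
    [CompleteSpace K] {v : ι → H} {w : ι → K} (hvw : ∀ i j, inner ℂ (w i) (w j) = inner ℂ (v i) (v j))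
    (hv : ∀ x, (∀ i, inner ℂ (v i) x = 0) → x = 0) (hw : ∀ x, (∀ i, inner ℂ (w i) x = 0) → x = 0) :
    ∃ U : H ≃ₗᵢ[ℂ] K, ∀ i, U (v i) = w i := by
  -- The norm of a finite combination depends only on the Gram matrix. Both dense spans are
  -- parametrised by the same coefficients, so the equivalence to extend is the identity of ι →₀ ℂ.
  have hnorm : ∀ c : ι →₀ ℂ, ‖Finsupp.linearCombination ℂ w (LinearEquiv.refl ℂ _ c)‖ =
      ‖Finsupp.linearCombination ℂ v c‖ := by
    intro c
    rw [norm_eq_sqrt_re_inner (𝕜 := ℂ), norm_eq_sqrt_re_inner (𝕜 := ℂ)]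
    simp only [LinearEquiv.refl_apply, Finsupp.linearCombination_apply, Finsupp.sum, sum_inner,
      inner_sum, inner_smul_left, inner_smul_right, hvw]
  refine ⟨(LinearEquiv.refl ℂ (ι →₀ ℂ)).extendOfIsometry _ _ (denseRange_linearCombination hv)
    (denseRange_linearCombination hw) hnorm, fun i => ?_⟩
  have h := LinearEquiv.extendOfIsometry_eq (LinearEquiv.refl ℂ (ι →₀ ℂ)) _ _
    (denseRange_linearCombination hv) (denseRange_linearCombination hw) hnorm (Finsupp.single i 1)
  simpa using h

lemma exists_isBargmannTransform : ∃ B : L2R ≃ₗᵢ[ℂ] FockSpace, IsBargmannTransform B := by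
  obtain ⟨B, hB⟩ := exists_linearIsometryEquiv_of_inner_eq (v := gaussianState)
    (w := FockSpace.kernel)
    (fun i j => by
      rw [FockSpace.inner_kernel, FockSpace.kernel_apply, inner_gaussianState,
        bargmannIntegral_gaussianState])
    (fun x hx => eq_zero_of_bargmannIntegral_eq_zero fun z => by rw [← inner_gaussianState, hx])
    (fun x hx => FockSpace.ext fun z => by
      rw [← FockSpace.inner_kernel, hx]
      rfl)
  refine ⟨B, fun f z => ⟨integrable_bargmannIntegrand f z, ?_⟩⟩
  rw [← FockSpace.inner_kernel, ← hB, B.inner_map_map, inner_gaussianState]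

/-! ### Intertwining with the Weyl operators. -/

lemma bargmannIntegral_modulation_translation (a b : ℝ) (f : L2R) (z : ℂ) :
    bargmannIntegral (modulation b (translation a f)) z =
      Complex.exp (Real.pi * a * b * I) *
        (bargmannIntegral f (z - (a - Real.pi * b * I)) *
          Complex.exp (z * conj (a - Real.pi * b * I : ℂ) -
            (‖(a - Real.pi * b * I : ℂ)‖ : ℂ) ^ 2 / 2)) := by
  have hae : modulation b (translation a f) =ᵐ[volume] fun x : ℝ =>
      Complex.exp (2 * Real.pi * I * b * x) * f (x - a) := by
    filter_upwards [coeFn_modulation b (translation a f), coeFn_translation a f] with x h1 h2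
    rw [h1, h2]
  have hconj : conj (a - Real.pi * b * I : ℂ) = a + Real.pi * b * I := by
    simp [Complex.conj_ofReal]
  -- Put w = a - πbi and compare exponents. On the right the terms linear in z alone cancel since w
  -- + w̄ = 2a, the extra x-term 2(a - w)x is the modulation 2πibx, and the leftover constant aw -
  -- a² = -πabi is removed by the scalar.
  have hint : bargmannIntegrand
      (fun x : ℝ => Complex.exp (2 * Real.pi * I * b * x) * f (x - a)) z = fun x : ℝ =>
      Complex.exp (Real.pi * a * b * I) * Complex.exp (z * conj (a - Real.pi * b * I : ℂ) -
        (‖(a - Real.pi * b * I : ℂ)‖ : ℂ) ^ 2 / 2) *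
      bargmannIntegrand f (z - (a - Real.pi * b * I)) (x - a) := by
    ext x
    rw [bargmannIntegrand, bargmannIntegrand, ← Complex.mul_conj', hconj, ← Complex.exp_add,
      mul_comm (Complex.exp _), mul_assoc, ← Complex.exp_add, mul_left_comm, ← Complex.exp_add]
    congr 2
    push_cast
    ring_nf
  rw [bargmannIntegral_congr hae, bargmannIntegral, bargmannIntegral, hint, integral_const_mul,
    integral_sub_right_eq_self (bargmannIntegrand f (z - (a - Real.pi * b * I))) a]
  ring

theorem theorem9 :
    ∃ B : L2R ≃ₗᵢ[ℂ] FockSpace, IsBargmannTransform B ∧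
      (∀ b : ℝ,
        (B : L2R →L[ℂ] FockSpace) ∘L modulation b ∘L (B.symm : FockSpace →L[ℂ] L2R)
          = weyl (-(Real.pi * b * Complex.I))) ∧
      (∀ a b : ℝ,
        (B : L2R →L[ℂ] FockSpace) ∘L (modulation b ∘L translation a) ∘L
            (B.symm : FockSpace →L[ℂ] L2R)
          = Complex.exp (Real.pi * a * b * Complex.I) • weyl (a - Real.pi * b * Complex.I)) ∧
      (∀ (a b : ℝ) (g : L2R),
        B (modulation b (translation a g))
          = Complex.exp (Real.pi * a * b * Complex.I) •
              weyl (a - Real.pi * b * Complex.I) (B g)) := by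
  obtain ⟨B, hB⟩ := exists_isBargmannTransform
  have key : ∀ (a b : ℝ) (g : L2R), B (modulation b (translation a g)) =
      Complex.exp (Real.pi * a * b * Complex.I) • weyl (a - Real.pi * b * Complex.I) (B g) := by
    intro a b g
    ext z
    rw [(hB _ z).2, FockSpace.smul_apply, weyl_apply, (hB g _).2,
      bargmannIntegral_modulation_translation]
  have htrans : ∀ g : L2R, translation 0 g = g := fun g => by
    apply Lp.ext
    filter_upwards [coeFn_translation 0 g] with x hx
    rw [hx, sub_zero]
  refine ⟨B, hB, fun b => ?_, fun a b => ?_, key⟩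
  · refine ContinuousLinearMap.ext fun f => ?_
    -- The modulation formula is the case a = 0, where the scalar is 1.
    have h := key 0 b (B.symm f)
    rw [htrans, B.apply_symm_apply] at h
    simpa using h
  · refine ContinuousLinearMap.ext fun f => ?_
    have h := key a b (B.symm f)
    rw [B.apply_symm_apply] at h
    exact h
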